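/- A matroid $M=(E,\mathcal B)$ consists of a finite ground set $E$ and a nonempty collection $\mathcal B=\mathcal B(M)$ of subsets of $E$ (the bases) satisfying the basis exchange axiom. Its base polytope is $P(M)=\operatorname{conv}\{\sum_{i\in B}e_i : B\in\mathcal B(M)\}\subset\mathbb R^{E}$. A hyperplane split of $P(M)$ is a decomposition $P(M)=P(M_1)\cup P(M_2)$, where $M_1,M_2$ are matroids on the ground set $E$ and $P(M_1)\cap P(M_2)$ is a face of both $P(M_1)$ and $P(M_2)$; it is nontrivial if $\mathcal B(M_i)\neq\mathcal B(M)$ for $i=1,2$. A matroid $M$ is graphic if there are a graph $G$ (loops and parallel edges allowed) and a bijection between $E$ and the edge set of $G$ under which the bases of $M$ correspond exactly to the edge sets of the spanning forests (maximal forests) of $G$. Corollary 8. If $M$ is a graphic matroid, then $P(M)$ has no nontrivial hyperplane split. In particular, $P(M(K_4))$ has no nontrivial hyperplane split, where $M(K_4)$ is the cycle matroid of the complete graph $K_4$ on four vertices, that is, the matroid whose ground set is the edge set of $K_4$ and whose bases are the edge sets of the spanning trees of $K_4$. -/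

import Mathlib

namespace Graph

/-- `v 0, e 0, v 1, e 1, …, v n, e n, v 0` is a cycle of length `n + 1` of the multigraph `G`:
distinct vertices, distinct edges, and `e i` joins `v i` to its cyclic successor `v (i + 1)`
(addition in `Fin (n + 1)` is cyclic). For `n = 0` this is a loop, for `n = 1` a pair of parallel
edges. -/
structure IsCycle {V β : Type*} (G : Graph V β) {n : ℕ} (v : Fin (n + 1) → V)
    (e : Fin (n + 1) → β) : Prop where
  vertex_injective : Function.Injective v
  edge_injective : Function.Injective e
  isLink : ∀ i, G.IsLink (e i) (v i) (v (i + 1))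

/-- `F` is the edge set of a forest of `G`: a set of edges of `G` that contains no cycle. -/
def IsForest {V β : Type*} (G : Graph V β) (F : Set β) : Prop :=
  F ⊆ G.edgeSet ∧
    ∀ (n : ℕ) (v : Fin (n + 1) → V) (e : Fin (n + 1) → β), G.IsCycle v e → ¬ Set.range e ⊆ F

/-- `F` is the edge set of a spanning forest of `G`, that is, of a maximal forest of `G`
(a spanning tree in every connected component). -/
def IsSpanningForest {V β : Type*} (G : Graph V β) (F : Set β) : Prop :=
  Maximal G.IsForest F

section CycleMatroid

/-- Auxiliary for the construction of the cycle matroid: the simple graph of the pairs of distinct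
vertices joined by an edge from `F`. -/
def adjOn {V β : Type*} (G : Graph V β) (F : Set β) : SimpleGraph V :=
  SimpleGraph.fromRel (fun x y => ∃ e ∈ F, G.IsLink e x y)

theorem adjOn_adj {V β : Type*} {G : Graph V β} {F : Set β} {x y : V} :
    (G.adjOn F).Adj x y ↔ x ≠ y ∧ ∃ e ∈ F, G.IsLink e x y := by
  simp only [adjOn, SimpleGraph.fromRel_adj]
  constructor
  · rintro ⟨h, h' | ⟨e, he, h'⟩⟩
    · exact ⟨h, h'⟩
    · exact ⟨h, e, he, h'.symm⟩
  · rintro ⟨h, h'⟩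
    exact ⟨h, Or.inl h'⟩

theorem IsLink.reachable {V β : Type*} {G : Graph V β} {F : Set β} {e : β} {x y : V}
    (h : G.IsLink e x y) (he : e ∈ F) : (G.adjOn F).Reachable x y := by
  by_cases hxy : x = y
  · subst hxy
    exact SimpleGraph.Reachable.refl _
  · exact (adjOn_adj.2 ⟨hxy, e, he, h⟩).reachable

open Fin.CommRing in
theorem IsCycle.reachable {V β : Type*} {G : Graph V β} {F : Set β} {n : ℕ} {v : Fin (n + 1) → V}
    {e : Fin (n + 1) → β} (h : G.IsCycle v e) (j : Fin (n + 1)) (hF : ∀ i, i ≠ j → e i ∈ F) :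
    (G.adjOn F).Reachable (v (j + 1)) (v j) := by
  have key : ∀ k : ℕ, k ≤ n → (G.adjOn F).Reachable (v (j + 1)) (v (j + 1 + (k : Fin (n + 1)))) := by
    intro k
    induction k with
    | zero => intro _; simp
    | succ k ih =>
      intro hk
      refine (ih (by omega)).trans ?_
      have h1 := h.isLink (j + 1 + (k : Fin (n + 1)))
      have h2 : j + 1 + (k : Fin (n + 1)) ≠ j := by
        intro h3
        have h4 : ((k + 1 : ℕ) : Fin (n + 1)) = 0 := by
          push_cast
          have : j + ((k : Fin (n + 1)) + 1) = j + 0 := by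
            rw [add_zero]; conv_rhs => rw [← h3]
            ring
          exact add_left_cancel this
        have h5 := congrArg Fin.val h4
        rw [Fin.val_natCast, Nat.mod_eq_of_lt (by omega)] at h5
        simp at h5
      have h6 := h1.reachable (hF _ h2)
      have h7 : j + 1 + ((k + 1 : ℕ) : Fin (n + 1)) = j + 1 + (k : Fin (n + 1)) + 1 := by
        push_cast; ring
      rw [h7]
      exact h6
  have := key n le_rfl
  have h8 : j + 1 + (n : Fin (n + 1)) = j := by
    have : ((n + 1 : ℕ) : Fin (n + 1)) = 0 := by simp
    push_cast at this
    calc j + 1 + (n : Fin (n + 1)) = j + ((n : Fin (n + 1)) + 1) := by ring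
      _ = j := by rw [this, add_zero]
  rwa [h8] at this

theorem exists_isCycle {V β : Type*} {G : Graph V β} {F : Set β} {e₀ : β} {x y : V}
    (hl : G.IsLink e₀ x y) (he : e₀ ∉ F) (h : (G.adjOn F).Reachable y x) :
    ∃ (n : ℕ) (v : Fin (n + 1) → V) (e : Fin (n + 1) → β),
      G.IsCycle v e ∧ Set.range e ⊆ insert e₀ F := by
  obtain ⟨p, hp⟩ := h.exists_isPath
  have hstep : ∀ i, i < p.length → ∃ f ∈ F, G.IsLink f (p.getVert i) (p.getVert (i + 1)) :=
    fun i hi => (adjOn_adj.1 (p.adj_getVert_succ hi)).2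
  have : Nonempty β := ⟨e₀⟩
  choose! f hfF hf using hstep
  have hinj : ∀ i j, i ≤ p.length → j ≤ p.length → p.getVert i = p.getVert j → i = j :=
    fun i j hi hj hij => hp.getVert_injOn hi hj hij
  refine ⟨p.length, fun i => p.getVert i, fun i => if i.val < p.length then f i else e₀,
    ⟨?_, ?_, ?_⟩, ?_⟩
  · intro i j hij
    exact Fin.ext (hinj i j (by omega) (by omega) hij)
  · intro i j hij
    dsimp only at hij
    split_ifs at hij with hi hj hj
    · have h1 := hf i hi
      have h2 := hf j hj
      rw [← hij] at h2
      rcases h1.eq_and_eq_or_eq_and_eq h2 with ⟨h3, -⟩ | ⟨h3, h4⟩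
      · exact Fin.ext (hinj i j (by omega) (by omega) h3)
      · have h5 := hinj i (j + 1) (by omega) (by omega) h3
        have h6 := hinj (i + 1) j (by omega) (by omega) h4
        omega
    · exact absurd (hij ▸ hfF i hi) he
    · exact absurd (hij ▸ hfF j hj) he
    · exact Fin.ext (by omega)
  · intro i
    split_ifs with hi
    · have h1 : (i + 1 : Fin (p.length + 1)).val = i.val + 1 :=
        Fin.val_add_one_of_lt' (by omega)
      rw [h1]
      exact hf i hi
    · have hi' : i = Fin.last p.length := Fin.ext (by simp; omega)
      subst hi'
      simpa using hl
  · rintro _ ⟨i, rfl⟩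
    dsimp only
    split_ifs with hi
    · exact Set.mem_insert_of_mem _ (hfF i hi)
    · exact Set.mem_insert _ _

theorem isForest_insert {V β : Type*} {G : Graph V β} {F : Set β} {e₀ : β} {x y : V}
    (hl : G.IsLink e₀ x y) (he : e₀ ∉ F) :
    G.IsForest (insert e₀ F) ↔ G.IsForest F ∧ ¬ (G.adjOn F).Reachable x y := by
  constructor
  · intro h
    refine ⟨⟨fun e h' => h.1 (Set.mem_insert_of_mem _ h'), fun n v e hc hF =>
      h.2 n v e hc (hF.trans (Set.subset_insert _ _))⟩, fun hr => ?_⟩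
    obtain ⟨n, v, e, hc, hF⟩ := exists_isCycle hl he hr.symm
    exact h.2 n v e hc hF
  · rintro ⟨hF, hr⟩
    refine ⟨Set.insert_subset hl.edge_mem hF.1, fun n v e hc hsub => ?_⟩
    by_cases hj : ∃ j, e j = e₀
    · obtain ⟨j, hj⟩ := hj
      have h1 := hc.reachable (F := F) j (fun i hi =>
        (hsub ⟨i, rfl⟩).resolve_left (fun h => hi (hc.edge_injective (h.trans hj.symm))))
      have h2 := hc.isLink j
      rw [hj] at h2
      rcases hl.eq_and_eq_or_eq_and_eq h2 with ⟨rfl, rfl⟩ | ⟨rfl, rfl⟩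
      · exact hr h1.symm
      · exact hr h1
    · push Not at hj
      refine hF.2 n v e hc ?_
      rintro _ ⟨i, rfl⟩
      exact (hsub ⟨i, rfl⟩).resolve_left (hj i)

theorem reachable_iff_mem_span {V β : Type*} {G : Graph V β} {F : Set β} (hF : F ⊆ G.edgeSet)
    {w : β → V →₀ ZMod 2}
    (hw : ∀ e x y, G.IsLink e x y → w e = Finsupp.single x 1 - Finsupp.single y 1) (x y : V) :
    (G.adjOn F).Reachable x y ↔
      Finsupp.single x 1 - Finsupp.single y 1 ∈ Submodule.span (ZMod 2) (w '' F) := by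
  classical
  constructor
  · rintro ⟨p⟩
    induction p with
    | nil => simp
    | @cons a b c hab p ih =>
      obtain ⟨-, e, he, hl⟩ := adjOn_adj.1 hab
      have h1 : Finsupp.single a 1 - Finsupp.single b 1 ∈ Submodule.span (ZMod 2) (w '' F) := by
        rw [← hw e a b hl]
        exact Submodule.subset_span ⟨e, he, rfl⟩
      simpa using add_mem h1 ih
  · intro h
    by_contra hr
    let φ : (V →₀ ZMod 2) →ₗ[ZMod 2] ZMod 2 :=
      Finsupp.linearCombination (ZMod 2) (fun v => if (G.adjOn F).Reachable x v then 1 else 0)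
    have hφ : Submodule.span (ZMod 2) (w '' F) ≤ LinearMap.ker φ := by
      rw [Submodule.span_le]
      rintro _ ⟨e, he, rfl⟩
      obtain ⟨a, b, hl⟩ := G.exists_isLink_of_mem_edgeSet (hF he)
      have hab := hl.reachable he
      have : (G.adjOn F).Reachable x a ↔ (G.adjOn F).Reachable x b :=
        ⟨fun h => h.trans hab, fun h => h.trans hab.symm⟩
      simp [hw e a b hl, φ, this]
    have := hφ h
    simp [φ, hr] at this

/-- Every multigraph has a vector representation over the two-element field (its incidence matrix)
for which the finite forests are the finite linearly independent sets of edges. -/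
theorem exists_incidence {V β : Type*} (G : Graph V β) :
    ∃ w : β → V →₀ ZMod 2,
      (∀ e x y, G.IsLink e x y → w e = Finsupp.single x 1 - Finsupp.single y 1) ∧
      ∀ F : Set β, F.Finite → F ⊆ G.edgeSet → (G.IsForest F ↔ LinearIndepOn (ZMod 2) w F) := by
  have h2 : ∀ a b : V →₀ ZMod 2, a - b = b - a := fun a b => by
    ext v
    simp only [Finsupp.sub_apply]
    rw [CharTwo.sub_eq_add, CharTwo.sub_eq_add, add_comm]
  have hex : ∀ e : β, ∃ z : V →₀ ZMod 2,
      ∀ x y, G.IsLink e x y → z = Finsupp.single x 1 - Finsupp.single y 1 := by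
    intro e
    by_cases he : ∃ a b, G.IsLink e a b
    · obtain ⟨a, b, hab⟩ := he
      refine ⟨Finsupp.single a 1 - Finsupp.single b 1, fun x y hxy => ?_⟩
      rcases hab.eq_and_eq_or_eq_and_eq hxy with ⟨rfl, rfl⟩ | ⟨rfl, rfl⟩
      · rfl
      · exact h2 _ _
    · exact ⟨0, fun x y h => absurd ⟨x, y, h⟩ he⟩
  choose w hw using hex
  refine ⟨w, hw, fun F hfin => ?_⟩
  induction F, hfin using Set.Finite.induction_on with
  | empty =>
    intro _
    refine ⟨fun _ => linearIndepOn_empty _ _, fun _ => ⟨Set.empty_subset _, fun n v e _ h => ?_⟩⟩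
    exact h ⟨0, rfl⟩
  | @insert e F he _ ih =>
    intro hF
    obtain ⟨a, b, hl⟩ := G.exists_isLink_of_mem_edgeSet (hF (Set.mem_insert _ _))
    have hF' := (Set.subset_insert e F).trans hF
    rw [isForest_insert hl he, linearIndepOn_insert he, ih hF', reachable_iff_mem_span hF' hw,
      hw e a b hl]

/-- The cycle matroid `M(G)` of a multigraph with finitely many edges: its ground set is the edge
set of `G`, and its independent sets are the edge sets of forests of `G`. -/
def cycleMatroid {V β : Type*} [Finite β] (G : Graph V β) : Matroid β :=
  (IndepMatroid.ofFinite (E := G.edgeSet) (Set.toFinite _) G.IsForest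
    (by
      refine ⟨Set.empty_subset _, fun n v e _ h => h ⟨0, rfl⟩⟩)
    (fun I J hJ hIJ => ⟨hIJ.trans hJ.1, fun n v e hc h => hJ.2 n v e hc (h.trans hIJ)⟩)
    (by
      intro I J hI hJ hlt
      obtain ⟨w, -, hw⟩ := G.exists_incidence
      by_contra! hcon
      have hIi := (hw I (Set.toFinite _) hI.1).1 hI
      have hJi := (hw J (Set.toFinite _) hJ.1).1 hJ
      have hsub : w '' J ⊆ Submodule.span (ZMod 2) (w '' I) := by
        rintro _ ⟨e, he, rfl⟩
        by_cases heI : e ∈ I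
        · exact Submodule.subset_span ⟨e, heI, rfl⟩
        · by_contra hn
          refine hcon e he heI ?_
          exact (hw _ (Set.toFinite _) (Set.insert_subset (hJ.1 he) hI.1)).2
            ((linearIndepOn_insert heI).2 ⟨hIi, hn⟩)
      have hle : Submodule.span (ZMod 2) (w '' J) ≤ Submodule.span (ZMod 2) (w '' I) :=
        Submodule.span_le.2 hsub
      have : FiniteDimensional (ZMod 2) (Submodule.span (ZMod 2) (w '' I)) :=
        FiniteDimensional.span_of_finite _ (Set.toFinite _)
      have h1 := Submodule.finrank_mono hle
      have hr : ∀ K : Set β, LinearIndepOn (ZMod 2) w K →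
          Module.finrank (ZMod 2) (Submodule.span (ZMod 2) (w '' K)) = K.ncard := by
        intro K hK
        have := Fintype.ofFinite K
        have h3 := finrank_span_eq_card hK
        rw [← Set.image_eq_range] at h3
        rw [h3, ← Nat.card_eq_fintype_card, Nat.card_coe_set_eq]
      rw [hr I hIi, hr J hJi] at h1
      omega)
    (fun I hI => hI.1)).matroid

/-- The bases of the cycle matroid are the spanning forests. -/
theorem cycleMatroid_isBase_iff {V β : Type*} [Finite β] (G : Graph V β) (B : Set β) :
    G.cycleMatroid.IsBase B ↔ G.IsSpanningForest B :=
  Matroid.isBase_iff_maximal_indep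

end CycleMatroid

end Graph

namespace Matroid

/-- `M` is graphic: there are a multigraph `G` and a bijection between the ground set of `M` and
the edge set of `G` under which the bases of `M` correspond to the spanning forests of `G`. -/
def IsGraphic {α : Type*} (M : Matroid α) : Prop :=
  ∃ (V β : Type) (G : Graph V β) (φ : M.E ≃ G.edgeSet),
    ∀ B : Set M.E, M.IsBase (Subtype.val '' B) ↔ G.IsSpanningForest (Subtype.val '' (φ '' B))

/-- The matroid base polytope `P(M)`: the convex hull of the incidence vectors
`∑ i ∈ B, e_i` of the bases `B` of `M`. -/
def basePolytope {α : Type*} (M : Matroid α) : Set (α → ℝ) :=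
  convexHull ℝ ((fun B : Set α => B.indicator (1 : α → ℝ)) '' {B | M.IsBase B})

/-- `P(M) = ⋃ i, P(N i)` is a matroid base polytope decomposition: the `N i` are matroids on the
ground set of `M`, and `P(N i) ∩ P(N j)` is a face of both `P(N i)` and `P(N j)` for `i ≠ j`.
(`IsExposed ℝ P F` says that `F` is empty or the set of maximizers on `P` of a linear functional,
which is a face in the sense of polytope theory.) -/
structure IsBasePolytopeDecomposition {α : Type*} (M : Matroid α) {t : ℕ}
    (N : Fin t → Matroid α) : Prop where
  ground_eq : ∀ i, (N i).E = M.E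
  iUnion_eq : M.basePolytope = ⋃ i, (N i).basePolytope
  isExposed_left : ∀ i j, i ≠ j →
    IsExposed ℝ (N i).basePolytope ((N i).basePolytope ∩ (N j).basePolytope)
  isExposed_right : ∀ i j, i ≠ j →
    IsExposed ℝ (N j).basePolytope ((N i).basePolytope ∩ (N j).basePolytope)

/-- `P(M)` has a nontrivial hyperplane split: a decomposition into `t = 2` base polytopes, neither
of which comes from a matroid with the same bases as `M`. -/
def HasNontrivialHyperplaneSplit {α : Type*} (M : Matroid α) : Prop :=
  ∃ N : Fin 2 → Matroid α, M.IsBasePolytopeDecomposition N ∧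
    ∀ i, {B | (N i).IsBase B} ≠ {B | M.IsBase B}

end Matroid

/-!
If the union of `P(N₁)` and `P(N₂)` is `P(M)` and a base `B₁` of `M` is not a base of `N₂`, then the
midpoint of every edge of `P(M)` at `B₁` lies in `P(N₁)`, so every base adjacent to `B₁` is a base
of `N₁`. When `M` has no minor `U_{2,4}`, this forces all bases of `M` into `N₁`, by induction on
`|B \ B₁|`: two elements of `B \ B₁` can be exchanged for two elements of `B₁ \ B`, which places `B`
in an octahedron `S ∪ {x, y}` opposite to a base nearer to `B₁`. The four remaining vertices are
nearer to `B₁` than `B` as well; one of them is not a base of `M`, and then basis exchange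
between two of the others in `N₁` yields `B`. Graphic matroids are representable over the
two-element field, and there three vectors of a plane that are pairwise independent sum to zero,
which excludes `U_{2,4}`.
-/

section BasePolytope

variable {α : Type*} {M N N₁ N₂ : Matroid α} {B B₁ : Set α}

theorem forall_mem_of_sum_indicator_eq_one {ι : Type*} [Fintype ι] {w : ι → ℝ} {C : ι → Set α}
    {x : α} (hw : ∀ i, 0 < w i) (hw₁ : ∑ i, w i = 1)
    (hx : ∑ i, w i * (C i).indicator (1 : α → ℝ) x = 1) (i : ι) : x ∈ C i := by
  by_contra hi
  have hle : ∀ j, (C j).indicator (1 : α → ℝ) x ≤ 1 :=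
    fun j => Set.indicator_le_self' (fun _ _ => zero_le_one) x
  have hlt : ∑ j, w j * (C j).indicator (1 : α → ℝ) x < ∑ j, w j :=
    Finset.sum_lt_sum (fun j _ => mul_le_of_le_one_right (hw j).le (hle j))
      ⟨i, Finset.mem_univ i, by simpa [hi] using hw i⟩
  exact hlt.ne (hx.trans hw₁.symm)

theorem sum_indicator_eq_zero_iff {ι : Type*} [Fintype ι] {w : ι → ℝ} {C : ι → Set α} {x : α}
    (hw : ∀ i, 0 < w i) :
    ∑ i, w i * (C i).indicator (1 : α → ℝ) x = 0 ↔ ∀ i, x ∉ C i := by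
  have hnonneg : ∀ i ∈ Finset.univ, 0 ≤ w i * (C i).indicator (1 : α → ℝ) x :=
    fun i _ => mul_nonneg (hw i).le (Set.indicator_nonneg (fun _ _ => zero_le_one) x)
  simp [Finset.sum_eq_zero_iff_of_nonneg hnonneg, (hw _).ne']

theorem exists_isBase_family_of_mem_basePolytope {p : α → ℝ} (hp : p ∈ M.basePolytope) :
    ∃ 𝒟 ⊆ {B | M.IsBase B}, 𝒟.Nonempty ∧ ⋃₀ 𝒟 = Function.support p ∧ {x | p x = 1} ⊆ ⋂₀ 𝒟 := by
  obtain ⟨ι, _, z, w, hz, -, hw, hw₁, rfl⟩ := eq_pos_convex_span_of_mem_convexHull hp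
  choose C hC hCz using fun i => hz (Set.mem_range_self i)
  have hcoord : ∀ x, (∑ i, w i • z i) x = ∑ i, w i * (C i).indicator (1 : α → ℝ) x := fun x => by
    simp [← hCz]
  have : Nonempty ι := by
    by_contra h
    simp [not_nonempty_iff.1 h] at hw₁
  refine ⟨Set.range C, Set.range_subset_iff.2 hC, Set.range_nonempty C, ?_, ?_⟩
  · ext x
    simp [-Finset.sum_apply, hcoord, sum_indicator_eq_zero_iff hw]
  · rintro x hx _ ⟨i, rfl⟩
    exact forall_mem_of_sum_indicator_eq_one hw hw₁ ((hcoord x).symm.trans hx) i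

theorem indicator_mem_basePolytope_iff :
    B.indicator (1 : α → ℝ) ∈ M.basePolytope ↔ M.IsBase B := by
  refine ⟨fun h => ?_, fun h => subset_convexHull ℝ _ ⟨B, h, rfl⟩⟩
  obtain ⟨𝒟, h𝒟, ⟨C, hC⟩, hsupp, hone⟩ := exists_isBase_family_of_mem_basePolytope h
  have hCB : C ⊆ B := (Set.subset_sUnion_of_mem hC).trans (hsupp.trans_subset (by simp))
  have hBC : B ⊆ C := fun x hx => hone (by simp [hx]) C hC
  exact hCB.antisymm hBC ▸ h𝒟 hC

theorem isBase_of_midpoint_mem_basePolytope (hNM : ∀ B, N.IsBase B → M.IsBase B) {y : α}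
    (hB : M.IsBase B) (hy : B \ B₁ = {y})
    (h : midpoint ℝ (B₁.indicator (1 : α → ℝ)) (B.indicator 1) ∈ N.basePolytope) :
    N.IsBase B := by
  obtain ⟨𝒟, h𝒟, -, hsupp, hone⟩ := exists_isBase_family_of_mem_basePolytope h
  have hyB : y ∈ B \ B₁ := hy ▸ Set.mem_singleton y
  obtain ⟨C, hC, hyC⟩ : y ∈ ⋃₀ 𝒟 := by
    rw [hsupp]
    simp [midpoint_eq_smul_add, hyB.1, hyB.2]
  have hBC : B ⊆ C := by
    intro x hx
    by_cases hx₁ : x ∈ B₁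
    · refine hone ?_ C hC
      norm_num [midpoint_eq_smul_add, hx, hx₁]
    · have hxy : x ∈ ({y} : Set α) := hy ▸ ⟨hx, hx₁⟩
      exact Set.mem_singleton_iff.1 hxy ▸ hyC
  exact hB.eq_of_subset_isBase (hNM C (h𝒟 hC)) hBC ▸ h𝒟 hC

theorem isBase_iff_of_basePolytope_eq_union
    (h : M.basePolytope = N₁.basePolytope ∪ N₂.basePolytope) :
    M.IsBase B ↔ N₁.IsBase B ∨ N₂.IsBase B := by
  simp only [← indicator_mem_basePolytope_iff, h, Set.mem_union]

theorem isBase_left_of_basePolytope_eq_union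
    (h : M.basePolytope = N₁.basePolytope ∪ N₂.basePolytope) (hB₁ : M.IsBase B₁)
    (hB₁' : ¬ N₂.IsBase B₁) (hB : M.IsBase B) (hsub : (B \ B₁).Subsingleton) : N₁.IsBase B := by
  have hbase (B : Set α) := isBase_iff_of_basePolytope_eq_union (B := B) h
  rcases hsub.eq_empty_or_singleton with hempty | ⟨y, hy⟩
  · obtain rfl := hB.eq_of_subset_isBase hB₁ (Set.sdiff_eq_empty.1 hempty)
    exact ((hbase B).1 hB).resolve_right hB₁'
  have hmid : midpoint ℝ (B₁.indicator (1 : α → ℝ)) (B.indicator 1) ∈ M.basePolytope :=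
    (convex_convexHull ℝ _).midpoint_mem (indicator_mem_basePolytope_iff.2 hB₁)
      (indicator_mem_basePolytope_iff.2 hB)
  rw [h] at hmid
  rcases hmid with hmid | hmid
  · exact isBase_of_midpoint_mem_basePolytope (fun B hB => (hbase B).2 (.inl hB)) hB hy hmid
  · obtain ⟨x, hx⟩ : ∃ x, B₁ \ B = {x} := by
      rw [← Set.encard_eq_one, hB₁.encard_sdiff_comm hB, hy, Set.encard_singleton]
    rw [midpoint_comm] at hmid
    exact absurd (isBase_of_midpoint_mem_basePolytope (fun B hB => (hbase B).2 (.inr hB))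
      hB₁ hx hmid) hB₁'

end BasePolytope

/-- `M` has no minor isomorphic to the uniform matroid `U_{2,4}`. Such a minor is encoded by a set
`T` of four elements and a set `S` with `(M ／ S) ↾ T = U_{2,4}`, where `S` is chosen so that its
union with any two elements of `T` is a base of `M`. -/
def IsU24Free {α : Type*} (M : Matroid α) : Prop :=
  ∀ S T : Set α, Disjoint S T → T.encard = 4 → ∃ P ⊆ T, P.encard = 2 ∧ ¬ M.IsBase (S ∪ P)

section Exchange

variable {α : Type*} {M N : Matroid α} {S B B₁ : Set α} {a b c d : α}

theorem isBase_union_pair_exchange (haS : a ∉ S) (hab : a ≠ b) (hac : a ≠ c) (had : a ≠ d)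
    (h₁ : M.IsBase (S ∪ {a, b})) (h₂ : M.IsBase (S ∪ {c, d})) :
    M.IsBase (S ∪ {b, c}) ∨ M.IsBase (S ∪ {b, d}) := by
  obtain ⟨y, ⟨hy, hy'⟩, hbase⟩ := h₁.exchange h₂ (e := a) ⟨by simp, by simp [haS, hac, had]⟩
  have hset : insert y ((S ∪ {a, b}) \ {a}) = S ∪ {b, y} := by grind
  rw [hset] at hbase
  have hycd : y = c ∨ y = d := by grind
  rcases hycd with rfl | rfl
  · exact .inl hbase
  · exact .inr hbase

theorem isBase_union_pair_of_not_isBase (haS : a ∉ S) (hcS : c ∉ S) (hab : a ≠ b) (hac : a ≠ c)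
    (had : a ≠ d) (hcb : c ≠ b) (hcd : c ≠ d) (hNM : ∀ B, N.IsBase B → M.IsBase B)
    (h₁ : M.IsBase (S ∪ {a, b})) (h₂ : M.IsBase (S ∪ {c, d})) (hbd : ¬ M.IsBase (S ∪ {b, d}))
    (hMN : ∀ x ∈ ({a, b} : Set α), ∀ y ∈ ({c, d} : Set α),
      M.IsBase (S ∪ {x, y}) → N.IsBase (S ∪ {x, y})) :
    N.IsBase (S ∪ {c, d}) := by
  have hbc : N.IsBase (S ∪ {b, c}) := hMN b (by simp) c (by simp)
    ((isBase_union_pair_exchange haS hab hac had h₁ h₂).resolve_right hbd)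
  have hda : M.IsBase (S ∪ {d, a}) :=
    (isBase_union_pair_exchange hcS hcd hac.symm hcb h₂ h₁).resolve_right
      (Set.pair_comm b d ▸ hbd)
  have had' : N.IsBase (S ∪ {a, d}) := hMN a (by simp) d (by simp) (Set.pair_comm d a ▸ hda)
  have hdc : N.IsBase (S ∪ {d, c}) :=
    (isBase_union_pair_exchange haS had hab hac had' hbc).resolve_left
      fun h => hbd (Set.pair_comm d b ▸ hNM _ h)
  rwa [Set.pair_comm]

theorem IsU24Free.exists_not_isBase_union_pair (hM : IsU24Free M) (hS : Disjoint S {a, b, c, d})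
    (hab : a ≠ b) (hac : a ≠ c) (had : a ≠ d) (hbc : b ≠ c) (hbd : b ≠ d) (hcd : c ≠ d)
    (h₁ : M.IsBase (S ∪ {a, b})) (h₂ : M.IsBase (S ∪ {c, d})) :
    ∃ x ∈ ({a, b} : Set α), ∃ y ∈ ({c, d} : Set α), ¬ M.IsBase (S ∪ {x, y}) := by
  obtain ⟨P, hP, hP₂, hnot⟩ := hM S {a, b, c, d} hS
    (Set.encard_eq_four.2 ⟨a, b, c, d, hab, hac, had, hbc, hbd, hcd, rfl⟩)
  obtain ⟨x, y, hxy, rfl⟩ := Set.encard_eq_two.1 hP₂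
  have hcomm := Set.pair_comm x y
  grind

theorem IsU24Free.isBase_of_forall_exchange (hM : IsU24Free M)
    (hNM : ∀ B, N.IsBase B → M.IsBase B) (hB : M.IsBase B) (hc : c ∈ B) (hd : d ∈ B)
    (hcd : c ≠ d) (ha : a ∉ B) (hb : b ∉ B) (hab : a ≠ b) (hB' : M.IsBase (B \ {c, d} ∪ {a, b}))
    (hMN : ∀ x ∈ ({a, b} : Set α), ∀ y ∈ ({c, d} : Set α),
      M.IsBase (B \ {c, d} ∪ {x, y}) → N.IsBase (B \ {c, d} ∪ {x, y})) :
    N.IsBase B := by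
  set S := B \ {c, d} with hS
  have hB_eq : S ∪ {c, d} = B :=
    Set.sdiff_union_of_subset (Set.insert_subset hc (Set.singleton_subset_iff.2 hd))
  have haS : a ∉ S := fun h => ha h.1
  have hbS : b ∉ S := fun h => hb h.1
  have hcS : c ∉ S := by simp [hS]
  have hdS : d ∉ S := by simp [hS]
  have hac : a ≠ c := fun h => ha (h ▸ hc)
  have had : a ≠ d := fun h => ha (h ▸ hd)
  have hbc : b ≠ c := fun h => hb (h ▸ hc)
  have hbd : b ≠ d := fun h => hb (h ▸ hd)
  rw [← hB_eq] at hB ⊢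
  obtain ⟨x, hx, y, hy, hxy⟩ := hM.exists_not_isBase_union_pair (by simp [*]) hab hac had hbc hbd
    hcd hB' hB
  have hba := Set.pair_comm a b
  have hdc := Set.pair_comm c d
  rcases hx with rfl | rfl <;> rcases hy with rfl | rfl
  · rw [hba] at hB' hMN
    rw [hdc] at hB hMN ⊢
    exact isBase_union_pair_of_not_isBase hbS hdS hab.symm hbd hbc had.symm hcd.symm hNM hB' hB
      hxy hMN
  · rw [hba] at hB' hMN
    exact isBase_union_pair_of_not_isBase hbS hcS hab.symm hbc hbd hac.symm hcd hNM hB' hB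
      hxy hMN
  · rw [hdc] at hB hMN ⊢
    exact isBase_union_pair_of_not_isBase haS hdS hab had hac hbd.symm hcd.symm hNM hB' hB
      hxy hMN
  · exact isBase_union_pair_of_not_isBase haS hcS hab hac had hbc.symm hcd hNM hB' hB hxy hMN

theorem exists_isBase_exchange_pair (hB : M.IsBase B) (hB₁ : M.IsBase B₁) (hc : c ∈ B \ B₁)
    (hd : d ∈ B \ B₁) (hcd : c ≠ d) :
    ∃ a ∈ B₁ \ B, ∃ b ∈ B₁ \ B, a ≠ b ∧ M.IsBase (B \ {c, d} ∪ {a, b}) := by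
  obtain ⟨B', hB', hsub, hsup⟩ :=
    (hB.indep.subset Set.sdiff_subset : M.Indep (B \ {c, d})).exists_isBase_subset_union_isBase hB₁
  have hsdiff : B \ B' = {c, d} := by grind
  have hcard : (B' \ B).encard = 2 := by
    rw [hB'.encard_sdiff_comm hB, hsdiff, Set.encard_pair hcd]
  obtain ⟨a, b, hab, hpair⟩ := Set.encard_eq_two.1 hcard
  have hB'_eq : B \ {c, d} ∪ {a, b} = B' := by grind
  have hpair_sub : {a, b} ⊆ B₁ \ B := hpair ▸ (by grind : B' \ B ⊆ B₁ \ B)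
  exact ⟨a, hpair_sub (by simp), b, hpair_sub (by simp), hab, hB'_eq ▸ hB'⟩

theorem sdiff_pair_union_pair_sdiff_ssubset {x y : α} (hc : c ∈ B \ B₁) (hd : d ∈ B \ B₁)
    (hcd : c ≠ d) (hx : x ∈ B₁) (hy : y ∈ ({c, d} : Set α)) :
    (B \ {c, d} ∪ {x, y}) \ B₁ ⊂ B \ B₁ := by
  rw [Set.ssubset_iff_exists]
  refine ⟨by grind, ?_⟩
  rcases hy with rfl | rfl
  · exact ⟨d, hd, by grind⟩
  · exact ⟨c, hc, by grind⟩

theorem IsU24Free.isBase_of_forall_subsingleton_sdiff [M.RankFinite] (hM : IsU24Free M)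
    (hNM : ∀ B, N.IsBase B → M.IsBase B) (hB₁ : M.IsBase B₁)
    (hstar : ∀ B, M.IsBase B → (B \ B₁).Subsingleton → N.IsBase B) (hB : M.IsBase B) :
    N.IsBase B := by
  induction hn : (B \ B₁).ncard using Nat.strong_induction_on generalizing B with
  | _ n ih =>
  subst hn
  rcases (B \ B₁).subsingleton_or_nontrivial with hsub | ⟨c, hc, d, hd, hcd⟩
  · exact hstar B hB hsub
  obtain ⟨a, ha, b, hb, hab, hB'⟩ := exists_isBase_exchange_pair hB hB₁ hc hd hcd
  refine hM.isBase_of_forall_exchange hNM hB hc.1 hd.1 hcd ha.2 hb.2 hab hB' ?_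
  intro x hx y hy hxy
  have hxB₁ : x ∈ B₁ := by rcases hx with rfl | rfl; exacts [ha.1, hb.1]
  exact ih _ (Set.ncard_lt_ncard (sdiff_pair_union_pair_sdiff_ssubset hc hd hcd hxB₁ hy)
    hB.finite.sdiff) hxy rfl

end Exchange

/-- The vectors `w e` represent the matroid `M` over `𝔽`: a subset of the ground set is independent
if and only if its vectors are linearly independent. The values of `w` off the ground set are
irrelevant. -/
def IsLinearRepresentation {α W : Type*} (𝔽 : Type*) [Field 𝔽] [AddCommGroup W] [Module 𝔽 W]
    (M : Matroid α) (w : α → W) : Prop :=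
  ∀ I ⊆ M.E, M.Indep I ↔ LinearIndepOn 𝔽 w I

section LinearRepresentation

variable {α W 𝔽 : Type*} [Field 𝔽] [AddCommGroup W] [Module 𝔽 W] {M : Matroid α} {w : α → W}
  {S P : Set α} {e : α}

theorem IsLinearRepresentation.mem_span_of_isBase {B : Set α}
    (hw : IsLinearRepresentation 𝔽 M w) (hB : M.IsBase B) (he : e ∈ M.E) :
    w e ∈ Submodule.span 𝔽 (w '' B) := by
  by_cases heB : e ∈ B
  · exact Submodule.subset_span ⟨e, heB, rfl⟩
  by_contra hnot
  have hins : LinearIndepOn 𝔽 w (insert e B) :=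
    (linearIndepOn_insert heB).2 ⟨(hw B hB.subset_ground).1 hB.indep, hnot⟩
  exact (hB.insert_dep ⟨he, heB⟩).not_indep ((hw _ (Set.insert_subset he hB.subset_ground)).2 hins)

theorem IsLinearRepresentation.linearIndepOn_mkQ_of_isBase_union
    (hw : IsLinearRepresentation 𝔽 M w) (hSP : Disjoint S P) (hB : M.IsBase (S ∪ P)) :
    LinearIndepOn 𝔽 ((Submodule.span 𝔽 (w '' S)).mkQ ∘ w) P :=
  ((linearIndepOn_union_iff_quotient hSP).1 ((hw _ hB.subset_ground).1 hB.indep)).2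

theorem IsLinearRepresentation.mkQ_mem_span_of_isBase_union
    (hw : IsLinearRepresentation 𝔽 M w) (hB : M.IsBase (S ∪ P)) (he : e ∈ M.E) :
    (Submodule.span 𝔽 (w '' S)).mkQ (w e) ∈
      Submodule.span 𝔽 ((Submodule.span 𝔽 (w '' S)).mkQ ∘ w '' P) := by
  have hmem := Submodule.mem_map_of_mem (f := (Submodule.span 𝔽 (w '' S)).mkQ)
    (hw.mem_span_of_isBase hB he)
  rwa [Set.image_union, Submodule.span_union, Submodule.map_sup, Submodule.mkQ_map_self,
    bot_sup_eq, Submodule.map_span, ← Set.image_comp] at hmem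

end LinearRepresentation

section Binary

theorem eq_add_of_mem_span_pair {W : Type*} [AddCommGroup W] [Module (ZMod 2) W] {x y z : W}
    (hz : z ∈ Submodule.span (ZMod 2) {x, y}) (hz₀ : z ≠ 0) (hzx : z ≠ x) (hzy : z ≠ y) :
    z = x + y := by
  have hzmod : ∀ t : ZMod 2, t = 0 ∨ t = 1 := by decide
  obtain ⟨s, t, rfl⟩ := Submodule.mem_span_pair.1 hz
  rcases hzmod s with rfl | rfl <;> rcases hzmod t with rfl | rfl <;> simp_all

theorem IsLinearRepresentation.isU24Free {α W : Type*} [AddCommGroup W] [Module (ZMod 2) W]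
    {M : Matroid α} {w : α → W} (hw : IsLinearRepresentation (ZMod 2) M w) : IsU24Free M := by
  intro S T hST hT
  by_contra! hbases
  let q : α → W ⧸ Submodule.span (ZMod 2) (w '' S) := Submodule.mkQ _ ∘ w
  have hbase : ∀ x ∈ T, ∀ y ∈ T, x ≠ y → M.IsBase (S ∪ {x, y}) := fun x hx y hy hxy =>
    hbases _ (Set.insert_subset hx (Set.singleton_subset_iff.2 hy)) (Set.encard_pair hxy)
  have hpair : ∀ x ∈ T, ∀ y ∈ T, x ≠ y → LinearIndepOn (ZMod 2) q {x, y} := fun x hx y hy hxy =>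
    hw.linearIndepOn_mkQ_of_isBase_union (by grind) (hbase x hx y hy hxy)
  have hne₀ : ∀ x ∈ T, ∀ y ∈ T, x ≠ y → q x ≠ 0 := fun x hx y hy hxy =>
    (hpair x hx y hy hxy).ne_zero (by simp)
  have hne : ∀ x ∈ T, ∀ y ∈ T, x ≠ y → q x ≠ q y := fun x hx y hy hxy h =>
    hxy ((hpair x hx y hy hxy).injOn (by simp) (by simp) h)
  obtain ⟨a, b, c, d, hab, hac, had, hbc, hbd, hcd, rfl⟩ := Set.encard_eq_four.1 hT
  have hsum : ∀ e ∈ ({c, d} : Set α), q e = q a + q b := by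
    intro e he
    have heT : e ∈ ({a, b, c, d} : Set α) := by grind
    have hea : e ≠ a := by grind
    have heb : e ≠ b := by grind
    have hspan : q e ∈ Submodule.span (ZMod 2) (q '' {a, b}) :=
      hw.mkQ_mem_span_of_isBase_union (hbase a (by simp) b (by simp) hab)
        ((hbase e heT a (by simp) hea).subset_ground (by simp))
    rw [Set.image_pair] at hspan
    exact eq_add_of_mem_span_pair hspan (hne₀ e heT a (by simp) hea)
      (hne e heT a (by simp) hea) (hne e heT b (by simp) heb)
  exact hne c (by simp) d (by simp) hcd ((hsum c (by simp)).trans (hsum d (by simp)).symm)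

end Binary

section Graphic

theorem indep_iff_isForest {α V β : Type*} {M : Matroid α} [M.Finite] {G : Graph V β}
    {φ : M.E ≃ G.edgeSet}
    (hφ : ∀ B : Set M.E, M.IsBase (Subtype.val '' B) ↔
      G.IsSpanningForest (Subtype.val '' (φ '' B))) (I : Set M.E) :
    M.Indep (Subtype.val '' I) ↔ G.IsForest (Subtype.val '' (φ '' I)) := by
  constructor
  · intro hI
    obtain ⟨B, hB, hIB⟩ := Matroid.indep_iff.1 hI
    obtain ⟨B, rfl⟩ := Set.subset_range_iff_exists_image_eq.1
      (hB.subset_ground.trans_eq Subtype.range_coe.symm)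
    have hsub : Subtype.val '' (φ '' I) ⊆ Subtype.val '' (φ '' B) :=
      Set.image_mono (Set.image_mono ((Set.image_subset_image_iff Subtype.val_injective).1 hIB))
    have hforest := ((hφ B).1 hB).prop
    exact ⟨hsub.trans hforest.1, fun n v e hve he => hforest.2 n v e hve (he.trans hsub)⟩
  · intro hI
    have hfin : Finite G.edgeSet :=
      have := M.ground_finite.to_subtype
      .of_equiv _ φ
    have hforests : {F | G.IsForest F}.Finite :=
      (Set.toFinite G.edgeSet).finite_subsets.subset fun F hF => hF.1
    obtain ⟨F, hIF, hF⟩ := hforests.exists_le_maximal hI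
    obtain ⟨F, rfl⟩ := Set.subset_range_iff_exists_image_eq.1
      (hF.prop.1.trans_eq Subtype.range_coe.symm)
    obtain ⟨B, rfl⟩ := φ.surjective.image_surjective F
    exact ((hφ B).2 hF).indep.subset (Set.image_mono ((Set.image_subset_image_iff φ.injective).1
      ((Set.image_subset_image_iff Subtype.val_injective).1 hIF)))

theorem exists_isLinearRepresentation_of_isGraphic {α : Type*} {M : Matroid α} [M.Finite]
    (hM : M.IsGraphic) :
    ∃ (V : Type) (w : α → V →₀ ZMod 2), IsLinearRepresentation (ZMod 2) M w := by
  obtain ⟨V, β, G, φ, hφ⟩ := hM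
  obtain ⟨w, -, hw⟩ := G.exists_incidence
  let u : α → V →₀ ZMod 2 := Function.extend Subtype.val (w ∘ Subtype.val ∘ φ) 0
  have hcomp : u ∘ Subtype.val = w ∘ Subtype.val ∘ φ :=
    Function.extend_comp Subtype.val_injective _ _
  have hinj : Function.Injective (Subtype.val ∘ φ) := Subtype.val_injective.comp φ.injective
  refine ⟨V, u, fun I hI => ?_⟩
  obtain ⟨I, rfl⟩ := Set.subset_range_iff_exists_image_eq.1 (hI.trans_eq Subtype.range_coe.symm)
  have hfin : (Subtype.val '' (φ '' I)).Finite :=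
    have := M.ground_finite.to_subtype
    Set.toFinite _
  have hsub : Subtype.val '' (φ '' I) ⊆ G.edgeSet := by grind
  rw [indep_iff_isForest hφ, hw _ hfin hsub, ← Set.image_comp]
  constructor
  · exact fun h => .image_of_comp _ _ (hcomp ▸ h.comp_of_image hinj.injOn)
  · exact fun h => .image_of_comp _ _ (hcomp ▸ h.comp_of_image Subtype.val_injective.injOn)

theorem isGraphic_cycleMatroid {V β : Type} [Finite β] (G : Graph V β) :
    G.cycleMatroid.IsGraphic := by
  have hbase (B : Set G.edgeSet) : G.cycleMatroid.IsBase (Subtype.val '' B) ↔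
      G.IsSpanningForest (Subtype.val '' (Equiv.refl G.edgeSet '' B)) := by
    rw [G.cycleMatroid_isBase_iff, Equiv.coe_refl, Set.image_id]
  exact ⟨V, β, G, Equiv.refl G.edgeSet, hbase⟩

theorem isU24Free_of_isGraphic {α : Type*} {M : Matroid α} [M.Finite] (hM : M.IsGraphic) :
    IsU24Free M :=
  let ⟨_, _, hw⟩ := exists_isLinearRepresentation_of_isGraphic hM
  hw.isU24Free

end Graphic

theorem corollary8_general {α : Type*} {M : Matroid α} [M.RankFinite] (hM : IsU24Free M)
    {N : Fin 2 → Matroid α} (hN : M.basePolytope = ⋃ i, (N i).basePolytope) :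
    ∃ i, {B | (N i).IsBase B} = {B | M.IsBase B} := by
  have hunion : M.basePolytope = (N 0).basePolytope ∪ (N 1).basePolytope := by
    rw [hN]
    ext
    simp [Fin.exists_fin_two]
  have hbase (B : Set α) := isBase_iff_of_basePolytope_eq_union (B := B) hunion
  by_cases hM₁ : ∀ B, M.IsBase B → (N 1).IsBase B
  · exact ⟨1, Set.ext fun B => ⟨fun hB => (hbase B).2 (.inr hB), hM₁ B⟩⟩
  push Not at hM₁
  obtain ⟨B₁, hB₁, hB₁'⟩ := hM₁
  refine ⟨0, Set.ext fun B => ⟨fun hB => (hbase B).2 (.inl hB), fun hB => ?_⟩⟩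
  exact hM.isBase_of_forall_subsingleton_sdiff (fun B hB => (hbase B).2 (.inl hB)) hB₁
    (fun B hB => isBase_left_of_basePolytope_eq_union hunion hB₁ hB₁' hB) hB

theorem IsU24Free.not_hasNontrivialHyperplaneSplit {α : Type*} {M : Matroid α} [M.RankFinite]
    (hM : IsU24Free M) : ¬ M.HasNontrivialHyperplaneSplit :=
  fun ⟨_, hN, hne⟩ => (corollary8_general hM hN.iUnion_eq).elim hne

theorem corollary8 :
    (∀ (α : Type*) [Finite α] (M : Matroid α), M.IsGraphic → ¬ M.HasNontrivialHyperplaneSplit) ∧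
      ¬ (Graph.ofSimpleGraph (⊤ : SimpleGraph (Fin 4))).cycleMatroid.HasNontrivialHyperplaneSplit :=
  ⟨fun _ _ _ hM => (isU24Free_of_isGraphic hM).not_hasNontrivialHyperplaneSplit,
    (isU24Free_of_isGraphic (isGraphic_cycleMatroid _)).not_hasNontrivialHyperplaneSplit⟩
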